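/- Let $1\le k\le n$. Consider $n$ nodes, each with an unbounded first-come-first-served queue. Jobs $j=0,1,2,\dots$ arrive one after the other at an initially empty system (with arbitrary random non-negative inter-arrival times), and job $j$ sends one sub-task to every node $i$, with random service time $S_j^i\ge 0$. No independence is assumed; the nodes are homogeneous, i.e. the joint law of the arrival process and of all service times is invariant under permutations of the nodes. In the basic $(n,n)$ queue the sojourn time of a job is the time from its arrival until all its sub-tasks are finished; in the non-purging $(n,k)$ queue it is the time until $k$ of its sub-tasks are finished, the others being still served; in the purging $(n,k)$ queue it is the time until $k$ of its sub-tasks are finished, and at that instant all remaining sub-tasks of the job are removed from the sub-queues and from service. The stable sojourn time is the limit in distribution, as $j\to\infty$, of the sojourn time of job $j$, and the expected sojourn time is the expectation of this limit. For $m\le n$, a basic $(m,m)$ queue is equivalent to the given queue if its arrival process and service times have the joint law of the arrival process and of the service times at $m$ distinct nodes of the given queue. Define integers, for $k\le i\le n$, by $$A^{n,k}_k=1,\qquad A^{n,k}_i=-\sum_{j=1}^{i-k}\binom{n-i+j}{j}A^{n,k}_{i-j}\quad(k<i\le n),\qquad W_i^{n,k}=\sum_{j=k}^{i}\binom nj A^{n,j}_i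 .$$ Suppose that for every $i\in\{k,\dots,n\}$ the equivalent basic $(i,i)$ fork-join queue has a stable sojourn time, with finite expectation $\mathbb T_i$. Then: 1. The equivalent non-purging $(n,k)$ fork-join queue has a stable sojourn time, and its expectation is finite and equal to $\sum_{i=k}^{n}W_i^{n,k}\,\mathbb T_i$. 2. If the purging $(n,k)$ fork-join queue has a stable sojourn time, then its expectation $\mathbb{PT}_{n,k}$ is finite and $$\mathbb{PT}_{n,k}\le\sum_{i=k}^{n}W_i^{n,k}\,\mathbb T_i .$$ 3. If the sequence of pairs (inter-arrival time from job $j$ to job $j+1$, service-time vector of job $j$), $j\ge 0$, is stationary, then the purging $(n,k)$ fork-join queue does have a stable sojourn time. -/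

import Mathlib

open MeasureTheory ProbabilityTheory Filter Topology

namespace ForkJoin

/-- The `k`-th smallest of the `m` real numbers `x i`, counted with multiplicity
(meaningful for `1 ≤ k ≤ m`). -/
noncomputable def orderStat {m : ℕ} (k : ℕ) (x : Fin m → ℝ) : ℝ :=
  sInf {t : ℝ | k ≤ (Finset.univ.filter fun i => x i ≤ t).card}

/-! ### The constants of the linear transformation -/

/-- The coefficients `A^{n,k}_i`, for `k ≤ i ≤ n`: `A^{n,k}_k = 1` and
`A^{n,k}_i = - ∑_{j=1}^{i-k} (n-i+j choose j) A^{n,k}_{i-j}` for `i > k`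
(the summation index below is `j - 1`). -/
def coeffA (n k : ℕ) (i : ℕ) : ℤ :=
  if i ≤ k then (if i = k then 1 else 0)
  else -∑ j : Fin (i - k), ((n - i + (j + 1)).choose (j + 1) : ℤ) * coeffA n k (i - (j + 1))
termination_by i
decreasing_by omega

/-- The coefficients `W^{n,k}_i = ∑_{j=k}^{i} (n choose j) A^{n,j}_i`, for `k ≤ i ≤ n`. -/
def coeffW (n k i : ℕ) : ℤ :=
  ∑ j ∈ Finset.Icc k i, (n.choose j : ℤ) * coeffA n j i

/-! ### Sample-path dynamics

Jobs are numbered `0, 1, 2, …`; `τ j` is the time between the arrivals of the jobs `j` and `j + 1`,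
and `S j i` is the service time of the sub-task of job `j` at node `i`. Job `0` arrives at time `0`
in an empty system. Every node serves its unbounded sub-queue first-come-first-served. -/

/-- Arrival time of job `j`. -/
def arrival (τ : ℕ → ℝ) (j : ℕ) : ℝ := ∑ l ∈ Finset.range j, τ l

/-- Without purging: the time at which node `i` finishes the sub-task of job `j`. The sub-task is
started when job `j` has arrived and node `i` has finished the previous sub-task. -/
noncomputable def finish {m : ℕ} (τ : ℕ → ℝ) (S : ℕ → Fin m → ℝ) : ℕ → Fin m → ℝ
  | 0 => fun i => arrival τ 0 + S 0 i
  | j + 1 => fun i => max (arrival τ (j + 1)) (finish τ S j i) + S (j + 1) i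

/-- With purging: the time at which node `i` would finish the sub-task of job `j` if this sub-task
were not purged. The `k`-th smallest of these times over the nodes is the time `C` at which job `j`
receives its `k`-th answer, and then all its remaining sub-tasks, waiting or in service, are
removed. Jobs thus receive their `k`-th answers in order of arrival, so no node works on a job
before `j` after time `C`, and node `i` becomes available to job `j + 1` at the minimum of `C` and
its own finishing time for job `j`. -/
noncomputable def purgingFinish {m : ℕ} (k : ℕ) (τ : ℕ → ℝ) (S : ℕ → Fin m → ℝ) :
    ℕ → Fin m → ℝ
  | 0 => fun i => arrival τ 0 + S 0 i
  | j + 1 => fun i =>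
      max (arrival τ (j + 1))
        (min (purgingFinish k τ S j i) (orderStat k (purgingFinish k τ S j))) + S (j + 1) i

/-! ### Stochastic input -/

universe u v

/-- The random input (inter-arrival times and service times) of a fork-join queue with `m` nodes. No
independence is required. -/
structure Input (m : ℕ) where
  /-- the sample space -/
  Ω : Type u
  [mΩ : MeasurableSpace Ω]
  /-- the probability -/
  P : Measure Ω
  [isProb : IsProbabilityMeasure P]
  /-- `interarrival j` is the time between the arrivals of the jobs `j` and `j + 1` -/
  interarrival : ℕ → Ω → ℝ
  /-- `service j i` is the service time of the sub-task of job `j` at node `i` -/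
  service : ℕ → Fin m → Ω → ℝ
  measurable_interarrival : ∀ j, Measurable (interarrival j)
  measurable_service : ∀ j i, Measurable (service j i)
  interarrival_nonneg : ∀ j, ∀ᵐ ω ∂P, 0 ≤ interarrival j ω
  service_nonneg : ∀ j i, ∀ᵐ ω ∂P, 0 ≤ service j i ω

attribute [instance] Input.mΩ Input.isProb

namespace Input

variable {m n : ℕ}

/-- The joint law of the arrival process and of the service times at the nodes `f 0, f 1, …`. -/
noncomputable def law (Q : Input.{u} n) (f : Fin m → Fin n) :
    Measure ((ℕ → ℝ) × (ℕ → Fin m → ℝ)) :=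
  Q.P.map fun ω => (fun j => Q.interarrival j ω, fun j i => Q.service j (f i) ω)

/-- The nodes are interchangeable: permuting them does not change the law of the input. -/
def Homogeneous (Q : Input.{u} n) : Prop :=
  ∀ σ : Equiv.Perm (Fin n), Q.law σ = Q.law id

/-- `R` is the input of an `m`-node queue under the same job arrival process and with the same
service times (in law) as some `m` distinct nodes of `Q`; if `Q` is homogeneous, the choice of these
nodes is immaterial. -/
def Equivalent (R : Input.{v} m) (Q : Input.{u} n) : Prop :=
  ∃ f : Fin m ↪ Fin n, R.law id = Q.law f

/-- The input is stationary: its law does not change if the first job is deleted. -/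
def Stationary (Q : Input.{u} n) : Prop :=
  (Q.P.map fun ω => (fun j => Q.interarrival (j + 1) ω, fun j i => Q.service (j + 1) i ω)) =
    Q.law id

/-- Sojourn time of job `j` in the basic fork-join queue: from its arrival until all its sub-tasks
are finished. -/
noncomputable def basicSojourn (Q : Input.{u} n) (j : ℕ) (ω : Q.Ω) : ℝ :=
  (⨆ i, finish (fun l => Q.interarrival l ω) (fun l i => Q.service l i ω) j i)
    - arrival (fun l => Q.interarrival l ω) j

/-- Sojourn time of job `j` in the non-purging `(n,k)` fork-join queue: from its arrival until `k`
of its sub-tasks are finished. -/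
noncomputable def nonPurgingSojourn (Q : Input.{u} n) (k j : ℕ) (ω : Q.Ω) : ℝ :=
  orderStat k (finish (fun l => Q.interarrival l ω) (fun l i => Q.service l i ω) j)
    - arrival (fun l => Q.interarrival l ω) j

/-- Sojourn time of job `j` in the purging `(n,k)` fork-join queue. -/
noncomputable def purgingSojourn (Q : Input.{u} n) (k j : ℕ) (ω : Q.Ω) : ℝ :=
  orderStat k (purgingFinish k (fun l => Q.interarrival l ω) (fun l i => Q.service l i ω) j)
    - arrival (fun l => Q.interarrival l ω) j

/-- `ν` is the law of the stable sojourn time: the sojourn time `X j` of job `j` converges in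
distribution to `ν` as `j → ∞`. -/
def HasStableLaw (Q : Input.{u} n) (X : ℕ → Q.Ω → ℝ) (ν : ProbabilityMeasure ℝ) : Prop :=
  TendstoInDistribution X atTop (id : ℝ → ℝ) (fun _ => Q.P) (ν : Measure ℝ)

end Input

end ForkJoin

/-!
Since the nodes are interchangeable, the probability that all the sub-tasks of job `j` in a given
set of `i` nodes have sojourn time at most `t` depends only on `i`: it is the distribution function
at `t` of the sojourn time in the basic `(i,i)` queue. Inclusion-exclusion for the event that at
least `k` sub-tasks have sojourn time at most `t` then expresses the law of the sojourn time in the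
non-purging queue as a linear combination, with the coefficients `coeffW n k i` for every `j`, of
the laws in the basic queues. With the negative terms moved to the other side, this relation passes
to weak limits, which gives the stable law and its mean.

Along every sample path purging does not increase the sojourn times, so a stable law of the purging
queue is stochastically dominated by that of the non-purging queue. Deleting the first job does not
increase the sojourn times of the later jobs in the purging queue. For a stationary input these are
therefore stochastically increasing, and, being dominated by the stable law of the non-purging
queue, they form a tight sequence with a single limit point.
-/

namespace ForkJoin

section Binomial

theorem sum_range_neg_one_pow_mul_choose {M L : ℕ} (h : M < L) :
    ∑ l ∈ Finset.range L, (-1 : ℤ) ^ l * M.choose l = if M = 0 then 1 else 0 := by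
  rw [← Int.alternating_sum_range_choose]
  refine (Finset.sum_subset (Finset.range_subset_range.2 h) fun l _ hl => ?_).symm
  rw [Nat.choose_eq_zero_of_lt (by simpa using hl), Nat.cast_zero, mul_zero]

theorem sum_range_choose_mul_neg_one_pow_mul_choose {p m : ℕ} (hm : 0 < m) (hmp : m ≤ p) :
    ∑ j ∈ Finset.range (m + 1),
      ((p - m + j).choose j : ℤ) * ((-1) ^ (m - j) * p.choose (m - j)) = 0 := by
  have hterm : ∀ j ∈ Finset.range (m + 1),
      ((p - m + j).choose j : ℤ) * ((-1) ^ (m - j) * p.choose (m - j)) =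
        p.choose m * ((-1) ^ (m - j) * m.choose (m - j)) := by
    intro j hj
    have hj : j ≤ m := Finset.mem_range_succ_iff.1 hj
    have h := Nat.choose_mul (n := p) (k := m) (s := m - j) (m.sub_le j)
    rw [show p - (m - j) = p - m + j by omega, Nat.sub_sub_self hj] at h
    zify at h
    linear_combination (-(-1 : ℤ) ^ (m - j)) * h
  have hreflect := Finset.sum_range_reflect (fun l => (-1 : ℤ) ^ l * m.choose l) (m + 1)
  simp only [Nat.add_sub_cancel] at hreflect
  rw [Finset.sum_congr rfl hterm, ← Finset.mul_sum, hreflect,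
    sum_range_neg_one_pow_mul_choose m.lt_succ_self, if_neg hm.ne', mul_zero]

theorem sum_Icc_neg_one_pow_mul_choose_mul_choose {n N j : ℕ} (hN : N ≤ n) (hj : j ≤ n) :
    ∑ i ∈ Finset.Icc j n, (-1 : ℤ) ^ (i - j) * i.choose j * N.choose i =
      if N = j then 1 else 0 := by
  have hterm : ∀ l ∈ Finset.range (n + 1 - j),
      (-1 : ℤ) ^ (j + l - j) * (j + l).choose j * N.choose (j + l) =
        N.choose j * ((-1) ^ l * (N - j).choose l) := by
    intro l _
    have h := Nat.choose_mul (n := N) (k := j + l) (s := j) (j.le_add_right l)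
    rw [Nat.add_sub_cancel_left] at h ⊢
    zify at h
    linear_combination ((-1 : ℤ) ^ l) * h
  rw [← Finset.Ico_succ_right_eq_Icc, Nat.succ_eq_succ, Finset.sum_Ico_eq_sum_range,
    Finset.sum_congr rfl hterm, ← Finset.mul_sum, sum_range_neg_one_pow_mul_choose (by omega)]
  rcases lt_trichotomy N j with hlt | rfl | hlt
  · simp [Nat.choose_eq_zero_of_lt hlt, hlt.ne]
  · simp
  · rw [if_neg (by omega), if_neg (by omega), mul_zero]

end Binomial

section Coefficients

theorem coeffA_of_lt (n : ℕ) {k i : ℕ} (hki : k < i) :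
    coeffA n k i = -∑ j ∈ Finset.range (i - k),
      ((n - i + (j + 1)).choose (j + 1) : ℤ) * coeffA n k (i - (j + 1)) := by
  rw [coeffA, if_neg hki.not_ge, Fin.sum_univ_eq_sum_range fun j =>
    ((n - i + (j + 1)).choose (j + 1) : ℤ) * coeffA n k (i - (j + 1))]

theorem coeffA_eq {n k i : ℕ} (hki : k ≤ i) (hin : i ≤ n) :
    coeffA n k i = (-1) ^ (i - k) * (n - k).choose (i - k) := by
  induction i using Nat.strong_induction_on with
  | _ i ih =>
    rcases hki.eq_or_lt with rfl | hlt
    · simp [coeffA]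
    have hterm : ∀ j ∈ Finset.range (i - k),
        ((n - i + (j + 1)).choose (j + 1) : ℤ) * coeffA n k (i - (j + 1)) =
          ((n - k - (i - k) + (j + 1)).choose (j + 1) : ℤ) *
            ((-1) ^ (i - k - (j + 1)) * (n - k).choose (i - k - (j + 1))) := by
      intro j hj
      have hj := Finset.mem_range.1 hj
      rw [ih _ (by omega) (by omega) (by omega), Nat.sub_sub_sub_cancel_right hki,
        Nat.sub_right_comm]
    have hzero := sum_range_choose_mul_neg_one_pow_mul_choose (p := n - k) (Nat.sub_pos_of_lt hlt)
      (Nat.sub_le_sub_right hin k)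
    rw [Finset.sum_range_succ'] at hzero
    simp only [Nat.choose_zero_right, Nat.sub_zero] at hzero
    rw [coeffA_of_lt n hlt, Finset.sum_congr rfl hterm]
    linear_combination -hzero

/-- The weight of the `i`-element sets of events in the inclusion-exclusion formula for the
occurrence of at least `k` events. -/
def subsetWeight (k i : ℕ) : ℤ := ∑ j ∈ Finset.Icc k i, (-1) ^ (i - j) * (i.choose j : ℤ)

theorem coeffW_eq {n i : ℕ} (k : ℕ) (hin : i ≤ n) :
    coeffW n k i = n.choose i * subsetWeight k i := by
  rw [coeffW, subsetWeight, Finset.mul_sum]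
  refine Finset.sum_congr rfl fun j hj => ?_
  have hji := (Finset.mem_Icc.1 hj).2
  have h := Nat.choose_mul (n := n) hji
  zify at h
  rw [coeffA_eq hji hin]
  linear_combination (-(-1 : ℤ) ^ (i - j)) * h

theorem sum_subsetWeight_mul_choose {n N : ℕ} (k : ℕ) (hN : N ≤ n) :
    ∑ i ∈ Finset.Icc k n, subsetWeight k i * N.choose i = if k ≤ N then 1 else 0 := by
  have hcomm : ∀ i j, i ∈ Finset.Icc k n ∧ j ∈ Finset.Icc k i ↔
      i ∈ Finset.Icc j n ∧ j ∈ Finset.Icc k n := by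
    simp only [Finset.mem_Icc]; omega
  simp only [subsetWeight, Finset.sum_mul]
  rw [Finset.sum_comm' hcomm, Finset.sum_congr rfl fun j hj =>
    sum_Icc_neg_one_pow_mul_choose_mul_choose hN (Finset.mem_Icc.1 hj).2, Finset.sum_ite_eq]
  simp [hN]

end Coefficients

section InclusionExclusion

variable {ι Ω : Type*} [Fintype ι]

theorem ite_le_card_filter (p : ι → Prop) [DecidablePred p] (k : ℕ) :
    (if k ≤ (Finset.univ.filter p).card then 1 else 0 : ℝ) =
      ∑ i ∈ Finset.Icc k (Fintype.card ι), (subsetWeight k i : ℝ) *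
        ∑ I ∈ Finset.powersetCard i Finset.univ, if ∀ l ∈ I, p l then 1 else 0 := by
  have hcard := congrArg (Int.cast : ℤ → ℝ)
    (sum_subsetWeight_mul_choose k (Finset.card_le_univ (Finset.univ.filter p)))
  push_cast at hcard
  rw [← hcard]
  refine Finset.sum_congr rfl fun i _ => ?_
  rw [Finset.sum_boole, ← Finset.card_powersetCard]
  congr 3
  ext I
  simp [Finset.mem_powersetCard, Finset.subset_iff, and_comm]

variable [MeasurableSpace Ω] {p : ι → Ω → Prop} [∀ i, DecidablePred (p i)] {μ : Measure Ω}
  [IsFiniteMeasure μ]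

theorem measureReal_le_card_filter (hp : ∀ i, MeasurableSet {ω | p i ω}) (k : ℕ) :
    μ.real {ω | k ≤ (Finset.univ.filter fun i => p i ω).card} =
      ∑ i ∈ Finset.Icc k (Fintype.card ι), (subsetWeight k i : ℝ) *
        ∑ I ∈ Finset.powersetCard i Finset.univ, μ.real {ω | ∀ l ∈ I, p l ω} := by
  have hAll : ∀ I : Finset ι, MeasurableSet {ω | ∀ l ∈ I, p l ω} := fun I => by
    simpa only [Set.ofPred_forall] using I.measurableSet_biInter fun l _ => hp l
  have hCard : MeasurableSet {ω | k ≤ (Finset.univ.filter fun i => p i ω).card} := by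
    simp only [Finset.card_filter]
    exact measurableSet_le measurable_const <| Finset.measurable_sum _ fun i _ =>
      Measurable.ite (hp i) measurable_const measurable_const
  have hInt : ∀ I : Finset ι, Integrable ({ω | ∀ l ∈ I, p l ω}.indicator (1 : Ω → ℝ)) μ :=
    fun I => (integrable_const 1).indicator (hAll I)
  simp only [← integral_indicator_one hCard, ← integral_indicator_one (hAll _)]
  simp only [← integral_finsetSum _ fun I _ => hInt I, ← integral_const_mul]
  rw [← integral_finsetSum _ fun i _ => (integrable_finsetSum _ fun I _ => hInt I).const_mul _]
  exact integral_congr_ae <| .of_forall fun ω => by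
    simpa only [Set.indicator_apply, Pi.one_apply, Set.mem_ofPred_eq] using
      ite_le_card_filter (p · ω) k

theorem measureReal_le_card_filter_of_card (hp : ∀ i, MeasurableSet {ω | p i ω}) (k : ℕ)
    {q : ℕ → ℝ}
    (hq : ∀ I : Finset ι, k ≤ I.card → μ.real {ω | ∀ l ∈ I, p l ω} = q I.card) :
    μ.real {ω | k ≤ (Finset.univ.filter fun i => p i ω).card} =
      ∑ i ∈ Finset.Icc k (Fintype.card ι), (coeffW (Fintype.card ι) k i : ℝ) * q i := by
  rw [measureReal_le_card_filter hp]
  refine Finset.sum_congr rfl fun i hi => ?_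
  obtain ⟨hki, hin⟩ := Finset.mem_Icc.1 hi
  have hsum : ∀ I ∈ Finset.powersetCard i (Finset.univ : Finset ι),
      μ.real {ω | ∀ l ∈ I, p l ω} = q i := by
    intro I hI
    obtain rfl := (Finset.mem_powersetCard.1 hI).2
    exact hq I hki
  rw [Finset.sum_congr rfl hsum, Finset.sum_const, Finset.card_powersetCard, Finset.card_univ,
    nsmul_eq_mul, coeffW_eq k hin]
  push_cast
  ring

end InclusionExclusion

section OrderStatistics

theorem isClosed_le_card_filter_le {ι : Type*} [Fintype ι] (k : ℕ) (x : ι → ℝ) :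
    IsClosed {t : ℝ | k ≤ (Finset.univ.filter fun i => x i ≤ t).card} := by
  have hunion : {t : ℝ | k ≤ (Finset.univ.filter fun i => x i ≤ t).card} =
      ⋃ I ∈ {I : Finset ι | k ≤ I.card}, ⋂ i ∈ I, Set.Ici (x i) := by
    ext t
    simp only [Set.mem_ofPred_eq, Set.mem_iUnion, Set.mem_iInter, Set.mem_Ici, exists_prop]
    refine ⟨fun h => ⟨_, h, fun i hi => (Finset.mem_filter.1 hi).2⟩, ?_⟩
    rintro ⟨I, hI, h⟩
    exact hI.trans (Finset.card_le_card fun i hi =>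
      Finset.mem_filter.2 ⟨Finset.mem_univ i, h i hi⟩)
  rw [hunion]
  exact (Set.toFinite _).isClosed_biUnion fun I _ => isClosed_biInter fun i _ => isClosed_Ici

variable {m k : ℕ}

theorem orderStat_le_iff (hk : 1 ≤ k) (hkm : k ≤ m) (x : Fin m → ℝ) (t : ℝ) :
    orderStat k x ≤ t ↔ k ≤ (Finset.univ.filter fun i => x i ≤ t).card := by
  have hbdd : BddBelow {t : ℝ | k ≤ (Finset.univ.filter fun i => x i ≤ t).card} := by
    obtain ⟨b, hb⟩ := (Set.finite_range x).bddBelow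
    refine ⟨b, fun s hs => ?_⟩
    obtain ⟨i, hi⟩ := Finset.card_pos.1 (hk.trans hs)
    exact (hb ⟨i, rfl⟩).trans (Finset.mem_filter.1 hi).2
  have hne : {t : ℝ | k ≤ (Finset.univ.filter fun i => x i ≤ t).card}.Nonempty := by
    obtain ⟨b, hb⟩ := (Set.finite_range x).bddAbove
    refine ⟨b, ?_⟩
    simpa [fun i => hb ⟨i, rfl⟩] using hkm
  refine ⟨fun h => ?_, fun h => csInf_le hbdd h⟩
  have hmem : k ≤ (Finset.univ.filter fun i => x i ≤ orderStat k x).card :=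
    (isClosed_le_card_filter_le k x).csInf_mem hne hbdd
  exact hmem.trans (Finset.card_le_card
    (Finset.monotone_filter_right _ fun _ _ hi => le_trans hi h))

theorem orderStat_add_le (hk : 1 ≤ k) (hkm : k ≤ m) {x y : Fin m → ℝ} {c : ℝ}
    (h : ∀ i, x i + c ≤ y i) : orderStat k x + c ≤ orderStat k y := by
  rw [← le_sub_iff_add_le, orderStat_le_iff hk hkm]
  refine ((orderStat_le_iff hk hkm y _).1 le_rfl).trans (Finset.card_le_card
    (Finset.monotone_filter_right _ fun i _ hi => ?_))
  exact le_sub_iff_add_le.2 ((h i).trans hi)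

theorem orderStat_mono (hk : 1 ≤ k) (hkm : k ≤ m) {x y : Fin m → ℝ} (h : x ≤ y) :
    orderStat k x ≤ orderStat k y := by
  simpa using orderStat_add_le hk hkm (c := 0) fun i => by simpa using h i

theorem le_orderStat (hk : 1 ≤ k) (hkm : k ≤ m) {x : Fin m → ℝ} {c : ℝ} (h : ∀ i, c ≤ x i) :
    c ≤ orderStat k x := by
  obtain ⟨i, hi⟩ := Finset.card_pos.1 (hk.trans ((orderStat_le_iff hk hkm x _).1 le_rfl))
  exact (h i).trans (Finset.mem_filter.1 hi).2

theorem measurable_orderStat (hk : 1 ≤ k) (hkm : k ≤ m) :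
    Measurable (orderStat k : (Fin m → ℝ) → ℝ) := by
  refine measurable_of_Iic fun t => ?_
  simp only [Set.preimage, Set.mem_Iic, orderStat_le_iff hk hkm, Finset.card_filter]
  exact measurableSet_le measurable_const <| Finset.measurable_sum _ fun i _ =>
    Measurable.ite (measurableSet_le (measurable_pi_apply i) measurable_const)
      measurable_const measurable_const

end OrderStatistics

section LinearCombinations

open scoped BoundedContinuousFunction NNReal

variable {X ι γ : Type*} [MeasurableSpace X]

/-- The finite measure `μ` is the linear combination `∑ i ∈ s, w i • β i` of finite measures with
real weights. The terms with a negative weight stand on the left, so that every measure involved is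
nonnegative. -/
def IsLinearCombination (s : Finset ι) (w : ι → ℝ) (β : ι → FiniteMeasure X)
    (μ : FiniteMeasure X) : Prop :=
  μ + ∑ i ∈ s, (-w i).toNNReal • β i = ∑ i ∈ s, (w i).toNNReal • β i

theorem sum_mul_eq_sum_toNNReal_mul_sub (s : Finset ι) (w a : ι → ℝ) :
    ∑ i ∈ s, w i * a i =
      ∑ i ∈ s, ((w i).toNNReal : ℝ) * a i - ∑ i ∈ s, ((-w i).toNNReal : ℝ) * a i := by
  rw [← Finset.sum_sub_distrib]
  refine Finset.sum_congr rfl fun i _ => ?_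
  rw [← sub_mul, Real.coe_toNNReal', Real.coe_toNNReal', max_zero_sub_max_neg_zero_eq_self]

theorem integrable_sum_smul {s : Finset ι} (c : ι → ℝ≥0) {β : ι → FiniteMeasure X} {f : X → ℝ}
    (hf : ∀ i ∈ s, Integrable f (β i : Measure X)) :
    Integrable f ((∑ i ∈ s, c i • β i : FiniteMeasure X) : Measure X) := by
  rw [FiniteMeasure.toMeasure_sum]
  exact integrable_finsetSum_measure.2 fun i hi => (hf i hi).smul_measure_nnreal

theorem integral_sum_smul {s : Finset ι} (c : ι → ℝ≥0) {β : ι → FiniteMeasure X} {f : X → ℝ}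
    (hf : ∀ i ∈ s, Integrable f (β i : Measure X)) :
    ∫ x, f x ∂((∑ i ∈ s, c i • β i : FiniteMeasure X) : Measure X) =
      ∑ i ∈ s, (c i : ℝ) * ∫ x, f x ∂(β i : Measure X) := by
  simp only [FiniteMeasure.toMeasure_sum, FiniteMeasure.toMeasure_smul]
  rw [integral_finsetSum_measure fun i hi => (hf i hi).smul_measure_nnreal]
  simp only [integral_smul_nnreal_measure, NNReal.smul_def, smul_eq_mul]

namespace IsLinearCombination

variable {s : Finset ι} {w : ι → ℝ} {β : ι → FiniteMeasure X} {μ : FiniteMeasure X}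

theorem integrable (h : IsLinearCombination s w β μ) {f : X → ℝ}
    (hf : ∀ i ∈ s, Integrable f (β i : Measure X)) : Integrable f (μ : Measure X) := by
  have hadd := integrable_sum_smul (fun i => (w i).toNNReal) hf
  rw [← h, FiniteMeasure.toMeasure_add, integrable_add_measure] at hadd
  exact hadd.1

theorem integral_eq (h : IsLinearCombination s w β μ) {f : X → ℝ}
    (hf : ∀ i ∈ s, Integrable f (β i : Measure X)) :
    ∫ x, f x ∂(μ : Measure X) = ∑ i ∈ s, w i * ∫ x, f x ∂(β i : Measure X) := by
  rw [sum_mul_eq_sum_toNNReal_mul_sub, ← integral_sum_smul _ hf, ← integral_sum_smul _ hf, ← h,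
    FiniteMeasure.toMeasure_add, integral_add_measure (h.integrable hf) (integrable_sum_smul _ hf),
    add_sub_cancel_right]

end IsLinearCombination

theorem finiteMeasure_ext_of_Iic {μ ν : FiniteMeasure ℝ}
    (h : ∀ t, (μ : Measure ℝ).real (Set.Iic t) = (ν : Measure ℝ).real (Set.Iic t)) : μ = ν :=
  Subtype.ext (Measure.ext_of_Iic (μ : Measure ℝ) ν fun t =>
    (measureReal_eq_measureReal_iff (by simp) (by simp)).1 (h t))

theorem isLinearCombination_of_measureReal_Iic {s : Finset ι} {w : ι → ℝ}
    {β : ι → FiniteMeasure ℝ} {μ : FiniteMeasure ℝ}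
    (h : ∀ t, (μ : Measure ℝ).real (Set.Iic t) =
      ∑ i ∈ s, w i * (β i : Measure ℝ).real (Set.Iic t)) :
    IsLinearCombination s w β μ := by
  refine finiteMeasure_ext_of_Iic fun t => ?_
  have hsum : ∀ c : ι → ℝ≥0,
      ((∑ i ∈ s, c i • β i : FiniteMeasure ℝ) : Measure ℝ).real (Set.Iic t) =
        ∑ i ∈ s, (c i : ℝ) * (β i : Measure ℝ).real (Set.Iic t) := fun c => by
    simp only [← integral_indicator_one (measurableSet_Iic (a := t))]
    exact integral_sum_smul c fun i _ => (integrable_const 1).indicator measurableSet_Iic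
  rw [FiniteMeasure.toMeasure_add, measureReal_add_apply, hsum,
    hsum, h, sum_mul_eq_sum_toNNReal_mul_sub, sub_add_cancel]

variable [TopologicalSpace X]

theorem measure_le_of_forall_lintegral_le [HasOuterApproxClosed X] [BorelSpace X]
    {μ ν : Measure X} [IsFiniteMeasure μ] [μ.WeaklyRegular] [IsFiniteMeasure ν]
    (h : ∀ f : X →ᵇ ℝ≥0, ∫⁻ x, f x ∂μ ≤ ∫⁻ x, f x ∂ν) : μ ≤ ν := by
  have hclosed : ∀ F : Set X, IsClosed F → μ F ≤ ν F := fun F hF =>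
    le_of_tendsto_of_tendsto' (HasOuterApproxClosed.tendsto_lintegral_apprSeq hF μ)
      (HasOuterApproxClosed.tendsto_lintegral_apprSeq hF ν) fun n => h (hF.apprSeq n)
  refine Measure.le_intro fun s hs _ => ?_
  rw [hs.measure_eq_iSup_isClosed_of_ne_top (measure_ne_top μ s)]
  exact iSup₂_le fun F hF => iSup_le fun hFc => (hclosed F hFc).trans (measure_mono hF)

theorem testAgainstNN_add_measure (μ ν : FiniteMeasure X) (f : X →ᵇ ℝ≥0) :
    (μ + ν).testAgainstNN f = μ.testAgainstNN f + ν.testAgainstNN f := by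
  simp only [← ENNReal.coe_inj, ENNReal.coe_add, FiniteMeasure.testAgainstNN_coe_eq,
    FiniteMeasure.toMeasure_add, lintegral_add_measure]

theorem exists_toFiniteMeasure_eq_and_tendsto [OpensMeasurableSpace X] {L : Filter γ} [L.NeBot]
    {μ : γ → ProbabilityMeasure X} {μ₀ : FiniteMeasure X}
    (h : Tendsto (fun j => (μ j).toFiniteMeasure) L (𝓝 μ₀)) :
    ∃ ν : ProbabilityMeasure X, ν.toFiniteMeasure = μ₀ ∧ Tendsto μ L (𝓝 ν) := by
  have hmass : μ₀.mass = 1 := tendsto_nhds_unique h.mass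
    (by simp only [ProbabilityMeasure.mass_toFiniteMeasure, tendsto_const_nhds])
  have hprob : IsProbabilityMeasure (μ₀ : Measure X) :=
    ⟨by rw [← FiniteMeasure.ennreal_mass, hmass, ENNReal.coe_one]⟩
  exact ⟨⟨μ₀, hprob⟩, rfl,
    ProbabilityMeasure.tendsto_nhds_iff_toFiniteMeasure_tendsto_nhds L |>.2 h⟩

variable [TopologicalSpace.PseudoMetrizableSpace X] [BorelSpace X] {L : Filter γ} [L.NeBot]

theorem exists_add_eq_and_tendsto {μ α σ : γ → FiniteMeasure X} {α₀ σ₀ : FiniteMeasure X}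
    (h : ∀ j, μ j + α j = σ j) (hα : Tendsto α L (𝓝 α₀)) (hσ : Tendsto σ L (𝓝 σ₀)) :
    ∃ μ₀, μ₀ + α₀ = σ₀ ∧ Tendsto μ L (𝓝 μ₀) := by
  simp only [FiniteMeasure.tendsto_iff_forall_testAgainstNN_tendsto] at hα hσ ⊢
  have htest : ∀ f j, (μ j).testAgainstNN f + (α j).testAgainstNN f = (σ j).testAgainstNN f :=
    fun f j => by rw [← h j, testAgainstNN_add_measure]
  have hle : (α₀ : Measure X) ≤ σ₀ := measure_le_of_forall_lintegral_le fun f => by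
    simp only [← FiniteMeasure.testAgainstNN_coe_eq, ENNReal.coe_le_coe]
    exact le_of_tendsto_of_tendsto' (hα f) (hσ f) fun j => htest f j ▸ le_add_self
  let μ₀ : FiniteMeasure X := ⟨σ₀ - α₀, isFiniteMeasure_of_le (σ₀ : Measure X) Measure.sub_le⟩
  have hμ₀ : μ₀ + α₀ = σ₀ := Subtype.ext (Measure.sub_add_cancel_of_le hle)
  refine ⟨μ₀, hμ₀, fun f => ?_⟩
  rw [eq_tsub_of_add_eq ((testAgainstNN_add_measure μ₀ α₀ f).symm.trans (by rw [hμ₀]))]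
  exact ((hσ f).sub (hα f)).congr fun j => (eq_tsub_of_add_eq (htest f j)).symm

theorem exists_isLinearCombination_and_tendsto {s : Finset ι} {w : ι → ℝ}
    {μ : γ → FiniteMeasure X} {β : γ → ι → FiniteMeasure X} {β₀ : ι → FiniteMeasure X}
    (h : ∀ j, IsLinearCombination s w (β j) (μ j))
    (hβ : ∀ i ∈ s, Tendsto (β · i) L (𝓝 (β₀ i))) :
    ∃ μ₀, IsLinearCombination s w β₀ μ₀ ∧ Tendsto μ L (𝓝 μ₀) :=
  exists_add_eq_and_tendsto h
    (tendsto_finsetSum s fun i hi => (hβ i hi).const_smul (-w i).toNNReal)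
    (tendsto_finsetSum s fun i hi => (hβ i hi).const_smul (w i).toNNReal)

end LinearCombinations

theorem ae_mem_of_tendsto {X γ : Type*} [MeasurableSpace X] [TopologicalSpace X]
    [OpensMeasurableSpace X] [HasOuterApproxClosed X] {L : Filter γ} [L.NeBot]
    {μs : γ → ProbabilityMeasure X} {μ : ProbabilityMeasure X} (h : Tendsto μs L (𝓝 μ)) {F : Set X}
    (hF : IsClosed F) (hμs : ∀ j, ∀ᵐ x ∂(μs j : Measure X), x ∈ F) :
    ∀ᵐ x ∂(μ : Measure X), x ∈ F := by
  have hle := ProbabilityMeasure.le_liminf_measure_open_of_tendsto h hF.isOpen_compl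
  have hzero : ∀ j, (μs j : Measure X) Fᶜ = 0 := fun j => ae_iff.1 (hμs j)
  simp only [hzero, liminf_const, nonpos_iff_eq_zero] at hle
  exact ae_iff.2 hle

section StochasticOrder

/-- The usual stochastic order of laws on the real line: a law is smaller than another one if its
distribution function is everywhere at least as large. -/
def StochasticallyLE (μ ν : ProbabilityMeasure ℝ) : Prop :=
  ∀ t, (ν : Measure ℝ) (Set.Iic t) ≤ (μ : Measure ℝ) (Set.Iic t)

namespace StochasticallyLE

variable {μ ν ρ : ProbabilityMeasure ℝ}

theorem trans (hμν : StochasticallyLE μ ν) (hνρ : StochasticallyLE ν ρ) : StochasticallyLE μ ρ :=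
  fun t => (hνρ t).trans (hμν t)

theorem antisymm (hμν : StochasticallyLE μ ν) (hνμ : StochasticallyLE ν μ) : μ = ν :=
  Subtype.ext (Measure.ext_of_Iic (μ : Measure ℝ) ν fun t => (hνμ t).antisymm (hμν t))

theorem measure_Ioi_le (h : StochasticallyLE μ ν) (t : ℝ) :
    (μ : Measure ℝ) (Set.Ioi t) ≤ (ν : Measure ℝ) (Set.Ioi t) := by
  rw [← Set.compl_Iic, prob_compl_eq_one_sub measurableSet_Iic,
    prob_compl_eq_one_sub measurableSet_Iic]
  exact tsub_le_tsub_left (h t) 1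

theorem ae_nonneg (h : StochasticallyLE μ ν) (hμ : ∀ᵐ x ∂(μ : Measure ℝ), 0 ≤ x) :
    ∀ᵐ x ∂(ν : Measure ℝ), 0 ≤ x := by
  have hν : ∀ t < (0 : ℝ), ∀ᵐ x ∂(ν : Measure ℝ), t < x := fun t ht => by
    have hμt : (μ : Measure ℝ) (Set.Iic t) = 0 := by
      refine measure_mono_null (fun x hx => ?_) (ae_iff.1 hμ)
      exact not_le.2 (lt_of_le_of_lt hx ht)
    simpa [ae_iff, Set.Iic] using (h t).trans hμt.le
  have hseq : ∀ᵐ x ∂(ν : Measure ℝ), ∀ j : ℕ, -(1 / ((j : ℝ) + 1)) < x :=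
    ae_all_iff.2 fun j => hν _ (neg_neg_of_pos Nat.one_div_pos_of_nat)
  filter_upwards [hseq] with x hx
  simpa using le_of_tendsto' tendsto_one_div_add_atTop_nhds_zero_nat.neg fun j => (hx j).le

theorem lintegral_ofReal_le (h : StochasticallyLE μ ν) (hμ : ∀ᵐ x ∂(μ : Measure ℝ), 0 ≤ x) :
    ∫⁻ x, ENNReal.ofReal x ∂(μ : Measure ℝ) ≤ ∫⁻ x, ENNReal.ofReal x ∂(ν : Measure ℝ) := by
  rw [lintegral_eq_lintegral_meas_lt (μ : Measure ℝ) hμ aemeasurable_id,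
    lintegral_eq_lintegral_meas_lt (ν : Measure ℝ) (h.ae_nonneg hμ) aemeasurable_id]
  exact lintegral_mono h.measure_Ioi_le

theorem integrable (h : StochasticallyLE μ ν) (hμ : ∀ᵐ x ∂(μ : Measure ℝ), 0 ≤ x)
    (hν : Integrable (fun x : ℝ => x) (ν : Measure ℝ)) :
    Integrable (fun x : ℝ => x) (μ : Measure ℝ) :=
  (lintegral_ofReal_ne_top_iff_integrable measurable_id.aestronglyMeasurable hμ).1
    (ne_top_of_le_ne_top ((lintegral_ofReal_ne_top_iff_integrable
      measurable_id.aestronglyMeasurable (h.ae_nonneg hμ)).2 hν) (h.lintegral_ofReal_le hμ))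

theorem integral_le (h : StochasticallyLE μ ν) (hμ : ∀ᵐ x ∂(μ : Measure ℝ), 0 ≤ x)
    (hν : Integrable (fun x : ℝ => x) (ν : Measure ℝ)) :
    ∫ x, x ∂(μ : Measure ℝ) ≤ ∫ x, x ∂(ν : Measure ℝ) := by
  rw [← ENNReal.ofReal_le_ofReal_iff (integral_nonneg_of_ae (h.ae_nonneg hμ)),
    ofReal_integral_eq_lintegral_ofReal (h.integrable hμ hν) hμ,
    ofReal_integral_eq_lintegral_ofReal hν (h.ae_nonneg hμ)]
  exact h.lintegral_ofReal_le hμ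

theorem of_forall_lt
    (h : ∀ s t, t < s → (ν : Measure ℝ) (Set.Iic t) ≤ (μ : Measure ℝ) (Set.Iic s)) :
    StochasticallyLE μ ν := by
  intro t
  simp only [← ofReal_cdf] at h ⊢
  rw [← (cdf (μ : Measure ℝ)).iInf_Ioi_eq t]
  exact ENNReal.ofReal_le_ofReal (le_ciInf fun s =>
    (ENNReal.ofReal_le_ofReal_iff (cdf_nonneg _ _)).1 (h s t s.2))

theorem of_tendsto {γ : Type*} {L : Filter γ} [L.NeBot] {μs νs : γ → ProbabilityMeasure ℝ}
    (hμ : Tendsto μs L (𝓝 μ)) (hν : Tendsto νs L (𝓝 ν))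
    (h : ∀ᶠ j in L, StochasticallyLE (μs j) (νs j)) : StochasticallyLE μ ν :=
  of_forall_lt fun s t hts =>
    calc (ν : Measure ℝ) (Set.Iic t)
        ≤ (ν : Measure ℝ) (Set.Iio s) := measure_mono (Set.Iic_subset_Iio.2 hts)
      _ ≤ L.liminf fun j => (νs j : Measure ℝ) (Set.Iio s) :=
          ProbabilityMeasure.le_liminf_measure_open_of_tendsto hν isOpen_Iio
      _ ≤ L.liminf fun j => (μs j : Measure ℝ) (Set.Iic s) :=
          liminf_le_liminf (h.mono fun j hj => (measure_mono Set.Iio_subset_Iic_self).trans (hj s))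
      _ ≤ L.limsup fun j => (μs j : Measure ℝ) (Set.Iic s) := liminf_le_limsup
      _ ≤ (μ : Measure ℝ) (Set.Iic s) :=
          ProbabilityMeasure.limsup_measure_closed_le_of_tendsto hμ isClosed_Iic

theorem isTightMeasureSet_Icc (μ ν : ProbabilityMeasure ℝ) :
    IsTightMeasureSet {((ρ : ProbabilityMeasure ℝ) : Measure ℝ) |
      ρ ∈ {ρ | StochasticallyLE μ ρ ∧ StochasticallyLE ρ ν}} := by
  rw [isTightMeasureSet_iff_exists_isCompact_measure_compl_le]
  intro ε hε
  obtain ⟨K, hK, hKε⟩ := isTightMeasureSet_iff_exists_isCompact_measure_compl_le.1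
    ((isTightMeasureSet_singleton (μ := (μ : Measure ℝ))).union
      (isTightMeasureSet_singleton (μ := (ν : Measure ℝ)))) (ε / 2) (ENNReal.half_pos hε.ne')
  obtain ⟨a, ha⟩ := hK.bddBelow
  obtain ⟨b, hb⟩ := hK.bddAbove
  refine ⟨Set.Icc (a - 1) b, isCompact_Icc, ?_⟩
  rintro _ ⟨ρ, ⟨hμρ, hρν⟩, rfl⟩
  have hleft : (ρ : Measure ℝ) (Set.Iic (a - 1)) ≤ ε / 2 :=
    calc (ρ : Measure ℝ) (Set.Iic (a - 1)) ≤ (μ : Measure ℝ) (Set.Iic (a - 1)) := hμρ _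
      _ ≤ (μ : Measure ℝ) Kᶜ := measure_mono fun x hx hxK =>
          (sub_one_lt a).not_ge ((ha hxK).trans hx)
      _ ≤ ε / 2 := hKε _ (Or.inl rfl)
  have hright : (ρ : Measure ℝ) (Set.Ioi b) ≤ ε / 2 :=
    calc (ρ : Measure ℝ) (Set.Ioi b) ≤ (ν : Measure ℝ) (Set.Ioi b) := hρν.measure_Ioi_le b
      _ ≤ (ν : Measure ℝ) Kᶜ := measure_mono fun x hx hxK => (hb hxK).not_gt hx
      _ ≤ ε / 2 := hKε _ (Or.inr rfl)
  calc (ρ : Measure ℝ) (Set.Icc (a - 1) b)ᶜ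
      ≤ (ρ : Measure ℝ) (Set.Iic (a - 1) ∪ Set.Ioi b) := measure_mono fun x hx => by
        rw [Set.mem_compl_iff, Set.mem_Icc, not_and_or, not_le, not_le] at hx
        exact hx.imp le_of_lt id
    _ ≤ ε / 2 + ε / 2 := (measure_union_le _ _).trans (add_le_add hleft hright)
    _ = ε := ENNReal.add_halves ε

theorem exists_tendsto_of_monotone {γ : Type*} [Preorder γ] [Nonempty γ] [IsDirectedOrder γ]
    {μs : γ → ProbabilityMeasure ℝ} (hmono : ∀ i j, i ≤ j → StochasticallyLE (μs i) (μs j))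
    (hν : ∀ j, StochasticallyLE (μs j) ν) : ∃ μ, Tendsto μs atTop (𝓝 μ) := by
  obtain ⟨i₀⟩ := ‹Nonempty γ›
  have hcompact : IsCompact (closure {ρ | StochasticallyLE (μs i₀) ρ ∧ StochasticallyLE ρ ν}) :=
    isCompact_closure_of_isTightMeasureSet (isTightMeasureSet_Icc _ _)
  have hmem : ∀ᶠ j in atTop,
      μs j ∈ closure {ρ | StochasticallyLE (μs i₀) ρ ∧ StochasticallyLE ρ ν} :=
    (eventually_ge_atTop i₀).mono fun j hj => subset_closure ⟨hmono i₀ j hj, hν j⟩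
  have hlim : ∀ U : Ultrafilter γ, (U : Filter γ) ≤ atTop → ∃ ρ, Tendsto μs U (𝓝 ρ) :=
    fun U hU => (hcompact.ultrafilter_le_nhds (U.map μs) (le_principal_iff.2 (hU hmem))).imp
      fun ρ hρ => hρ.2
  -- Any two limits along ultrafilters bound each other, as each is an upper bound of the sequence.
  have hle : ∀ (U V : Ultrafilter γ) (ρ σ : ProbabilityMeasure ℝ), (V : Filter γ) ≤ atTop →
      Tendsto μs U (𝓝 ρ) → Tendsto μs V (𝓝 σ) → StochasticallyLE ρ σ := by
    intro U V ρ σ hV hρ hσ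
    have hub : ∀ i, StochasticallyLE (μs i) σ := fun i =>
      of_tendsto tendsto_const_nhds hσ (hV ((eventually_ge_atTop i).mono (hmono i)))
    exact of_tendsto hρ tendsto_const_nhds (.of_forall hub)
  obtain ⟨μ, hμ⟩ := hlim (Ultrafilter.of atTop) (Ultrafilter.of_le atTop)
  refine ⟨μ, (tendsto_iff_ultrafilter _ _ _).2 fun U hU => ?_⟩
  obtain ⟨ρ, hρ⟩ := hlim U hU
  have heq : ρ = μ := (hle _ _ ρ μ (Ultrafilter.of_le atTop) hρ hμ).antisymm (hle _ _ μ ρ hU hμ hρ)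
  exact heq ▸ hρ

end StochasticallyLE

end StochasticOrder

section SamplePaths

/-- The sample paths of the input of an `m`-node queue: the inter-arrival times and the service
times. -/
abbrev Path (m : ℕ) := (ℕ → ℝ) × (ℕ → Fin m → ℝ)

theorem arrival_succ_eq (τ : ℕ → ℝ) (j : ℕ) :
    arrival τ (j + 1) = arrival (fun l => τ (l + 1)) j + τ 0 :=
  Finset.sum_range_succ' _ _

theorem arrival_le_purgingFinish {m : ℕ} (k : ℕ) (τ : ℕ → ℝ) {S : ℕ → Fin m → ℝ}
    (hS : ∀ j i, 0 ≤ S j i) (j : ℕ) (i : Fin m) : arrival τ j ≤ purgingFinish k τ S j i := by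
  cases j with
  | zero => exact le_add_of_nonneg_right (hS 0 i)
  | succ j => exact (le_max_left _ _).trans (le_add_of_nonneg_right (hS _ i))

theorem purgingFinish_le_finish {m : ℕ} (k : ℕ) (τ : ℕ → ℝ) (S : ℕ → Fin m → ℝ) (j : ℕ) :
    purgingFinish k τ S j ≤ finish τ S j := by
  induction j with
  | zero => exact le_rfl
  | succ j ih =>
    intro i
    exact add_le_add_left (max_le_max le_rfl ((min_le_left _ _).trans (ih i))) _

theorem purgingFinish_shift_le {m k : ℕ} (hk : 1 ≤ k) (hkm : k ≤ m) (τ : ℕ → ℝ)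
    (S : ℕ → Fin m → ℝ) (j : ℕ) (i : Fin m) :
    purgingFinish k (fun l => τ (l + 1)) (fun l => S (l + 1)) j i + τ 0 ≤
      purgingFinish k τ S (j + 1) i := by
  induction j generalizing i with
  | zero =>
    rw [purgingFinish, purgingFinish.eq_2 k τ S 0, add_right_comm, ← arrival_succ_eq]
    exact add_le_add_left (le_max_left _ _) _
  | succ j ih =>
    rw [purgingFinish, purgingFinish.eq_2 k τ S (j + 1), add_right_comm, ← max_add_add_right,
      ← min_add_add_right, ← arrival_succ_eq]
    exact add_le_add_left
      (max_le_max le_rfl (min_le_min (ih i) (orderStat_add_le hk hkm ih))) _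

namespace Path

variable {m n : ℕ}

/-- The sample path of the queue formed by the nodes `f 0, f 1, …`. -/
def restrict (f : Fin m → Fin n) (p : Path n) : Path m := (p.1, fun j i => p.2 j (f i))

/-- The sample path with the first job deleted. -/
def shift (p : Path m) : Path m := (fun j => p.1 (j + 1), fun j i => p.2 (j + 1) i)

/-- The time from the arrival of job `j` until node `i` finishes its sub-task, without purging. -/
noncomputable def nodeSojourn (p : Path m) (j : ℕ) (i : Fin m) : ℝ :=
  finish p.1 p.2 j i - arrival p.1 j

/-- The sojourn time of job `j` in the purging `(m,k)` queue. -/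
noncomputable def purgingSojourn (k j : ℕ) (p : Path m) : ℝ :=
  orderStat k (purgingFinish k p.1 p.2 j) - arrival p.1 j

theorem finish_restrict (f : Fin m → Fin n) (p : Path n) (j : ℕ) (l : Fin m) :
    finish (p.restrict f).1 (p.restrict f).2 j l = finish p.1 p.2 j (f l) := by
  induction j with
  | zero => rfl
  | succ j ih => simp only [finish, ih]; rfl

theorem nodeSojourn_restrict (f : Fin m → Fin n) (p : Path n) (j : ℕ) (l : Fin m) :
    (p.restrict f).nodeSojourn j l = p.nodeSojourn j (f l) :=
  congrArg (· - _) (finish_restrict f p j l)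

theorem purgingSojourn_shift_le {k : ℕ} (hk : 1 ≤ k) (hkm : k ≤ m) (j : ℕ) (p : Path m) :
    p.shift.purgingSojourn k j ≤ p.purgingSojourn k (j + 1) := by
  have hfinish := orderStat_add_le hk hkm (purgingFinish_shift_le hk hkm p.1 p.2 j)
  rw [purgingSojourn, purgingSojourn, arrival_succ_eq, sub_add_eq_sub_sub, sub_right_comm]
  exact sub_le_sub_right (le_sub_iff_add_le.2 hfinish) _

theorem measurable_service (j : ℕ) (i : Fin m) : Measurable fun p : Path m => p.2 j i :=
  (measurable_pi_apply i).comp ((measurable_pi_apply j).comp measurable_snd)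

theorem measurable_arrival (j : ℕ) : Measurable fun p : Path m => arrival p.1 j :=
  Finset.measurable_sum _ fun l _ => (measurable_pi_apply l).comp measurable_fst

theorem measurable_restrict (f : Fin m → Fin n) : Measurable (restrict f) :=
  measurable_fst.prodMk <| measurable_pi_lambda _ fun j => measurable_pi_lambda _ fun i =>
    measurable_service j (f i)

theorem measurable_shift : Measurable (shift : Path m → Path m) :=
  (measurable_pi_lambda _ fun j => (measurable_pi_apply (j + 1)).comp measurable_fst).prodMk <|
    measurable_pi_lambda _ fun j => measurable_pi_lambda _ fun i => measurable_service (j + 1) i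

theorem measurable_finish (j : ℕ) (i : Fin m) :
    Measurable fun p : Path m => finish p.1 p.2 j i := by
  induction j with
  | zero => exact (measurable_arrival 0).add (measurable_service 0 i)
  | succ j ih => exact ((measurable_arrival (j + 1)).max ih).add (measurable_service (j + 1) i)

theorem measurable_nodeSojourn (j : ℕ) (i : Fin m) :
    Measurable fun p : Path m => p.nodeSojourn j i :=
  (measurable_finish j i).sub (measurable_arrival j)

theorem measurable_purgingFinish {k : ℕ} (hk : 1 ≤ k) (hkm : k ≤ m) (j : ℕ) :
    Measurable fun p : Path m => purgingFinish k p.1 p.2 j := by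
  induction j with
  | zero =>
    exact measurable_pi_lambda _ fun i => (measurable_arrival 0).add (measurable_service 0 i)
  | succ j ih =>
    exact measurable_pi_lambda _ fun i => ((measurable_arrival (j + 1)).max
      (((measurable_pi_apply i).comp ih).min ((measurable_orderStat hk hkm).comp ih))).add
      (measurable_service (j + 1) i)

theorem measurable_purgingSojourn {k : ℕ} (hk : 1 ≤ k) (hkm : k ≤ m) (j : ℕ) :
    Measurable fun p : Path m => p.purgingSojourn k j :=
  ((measurable_orderStat hk hkm).comp (measurable_purgingFinish hk hkm j)).sub
    (measurable_arrival j)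

end Path

end SamplePaths

universe u v

namespace Input

section Laws

variable {l m n : ℕ}

/-- The sample path of the input at a sample point. -/
def path (Q : Input.{u} n) (ω : Q.Ω) : Path n :=
  (fun j => Q.interarrival j ω, fun j i => Q.service j i ω)

theorem measurable_path (Q : Input.{u} n) : Measurable Q.path :=
  (measurable_pi_lambda _ Q.measurable_interarrival).prodMk
    (measurable_pi_lambda _ fun j => measurable_pi_lambda _ (Q.measurable_service j))

theorem map_restrict_law (Q : Input.{u} n) (g : Fin m → Fin n) (f : Fin l → Fin m) :
    (Q.law g).map (Path.restrict f) = Q.law (g ∘ f) :=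
  Measure.map_map (Path.measurable_restrict f)
    ((Path.measurable_restrict g).comp Q.measurable_path)

theorem Homogeneous.law_eq {Q : Input.{u} n} (hQ : Q.Homogeneous) (f g : Fin m ↪ Fin n) :
    Q.law f = Q.law g := by
  obtain ⟨σ, hσ⟩ := (Equiv.Perm.isMultiplyPretransitive (Fin n) m).exists_smul_eq f g
  have hσf : (g : Fin m → Fin n) = σ ∘ f := by rw [← hσ]; rfl
  rw [hσf, ← map_restrict_law, hQ σ, map_restrict_law, Function.id_comp]

theorem basicSojourn_le_iff [Nonempty (Fin m)] (R : Input.{v} m) (j : ℕ) (ω : R.Ω) (t : ℝ) :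
    R.basicSojourn j ω ≤ t ↔ ∀ i, (R.path ω).nodeSojourn j i ≤ t := by
  rw [basicSojourn, sub_le_iff_le_add, ciSup_le_iff (Set.finite_range _).bddAbove]
  exact forall_congr' fun i => sub_le_iff_le_add.symm

theorem Homogeneous.measureReal_basicSojourn_le {Q : Input.{u} n} (hQ : Q.Homogeneous)
    {I : Finset (Fin n)} (hI : I.Nonempty) {R : Input.{v} I.card} (hR : R.Equivalent Q) (j : ℕ)
    (t : ℝ) :
    R.P.real {ω | R.basicSojourn j ω ≤ t} =
      Q.P.real {ω | ∀ i ∈ I, (Q.path ω).nodeSojourn j i ≤ t} := by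
  obtain ⟨f, hf⟩ := hR
  have : Nonempty (Fin I.card) := ⟨⟨0, hI.card_pos⟩⟩
  let g : Fin I.card ↪ Fin n := (I.orderEmbOfFin rfl).toEmbedding
  have hg : ∀ p : Path n, (∀ i ∈ I, p.nodeSojourn j i ≤ t) ↔
      ∀ i, (p.restrict g).nodeSojourn j i ≤ t := fun p => by
    simp only [Path.nodeSojourn_restrict]
    have hrange : Set.range g = I := I.range_orderEmbOfFin rfl
    rw [← Set.forall_mem_range (p := (p.nodeSojourn j · ≤ t)), hrange]
    rfl
  have hmeas : MeasurableSet {p : Path I.card | ∀ i, p.nodeSojourn j i ≤ t} := by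
    simp only [Set.ofPred_forall]
    exact .iInter fun i => measurableSet_le (Path.measurable_nodeSojourn j i) measurable_const
  have hlaw : R.P.map R.path = Q.P.map fun ω => (Q.path ω).restrict g :=
    hf.trans (hQ.law_eq f g)
  simp only [basicSojourn_le_iff, hg]
  calc R.P.real {ω | ∀ i, (R.path ω).nodeSojourn j i ≤ t}
      = (R.P.map R.path).real {p | ∀ i, p.nodeSojourn j i ≤ t} :=
        (map_measureReal_apply R.measurable_path hmeas).symm
    _ = Q.P.real {ω | ∀ i, ((Q.path ω).restrict g).nodeSojourn j i ≤ t} := by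
        rw [hlaw]
        exact map_measureReal_apply ((Path.measurable_restrict g).comp Q.measurable_path) hmeas

end Laws

section Distributions

variable {n : ℕ} (Q : Input.{u} n)

/-- The distribution of a real random variable on the sample space of an input, as a point of the
space of probability measures with the topology of weak convergence. -/
noncomputable def distribution (X : Q.Ω → ℝ) (hX : Measurable X) : ProbabilityMeasure ℝ :=
  ⟨Q.P.map X, Measure.isProbabilityMeasure_map hX.aemeasurable⟩

variable {Q}

theorem distribution_real_Iic {X : Q.Ω → ℝ} (hX : Measurable X) (t : ℝ) :
    (Q.distribution X hX : Measure ℝ).real (Set.Iic t) = Q.P.real {ω | X ω ≤ t} :=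
  map_measureReal_apply hX measurableSet_Iic

theorem distribution_ae_nonneg {X : Q.Ω → ℝ} (hX : Measurable X) (h : ∀ᵐ ω ∂Q.P, 0 ≤ X ω) :
    ∀ᵐ x ∂(Q.distribution X hX : Measure ℝ), 0 ≤ x :=
  (ae_map_iff hX.aemeasurable measurableSet_Ici).2 h

theorem stochasticallyLE_distribution {X Y : Q.Ω → ℝ} (hX : Measurable X) (hY : Measurable Y)
    (h : X ≤ᵐ[Q.P] Y) : StochasticallyLE (Q.distribution X hX) (Q.distribution Y hY) := by
  intro t
  rw [distribution, distribution, ProbabilityMeasure.coe_mk, ProbabilityMeasure.coe_mk,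
    Measure.map_apply hX measurableSet_Iic, Measure.map_apply hY measurableSet_Iic]
  exact measure_mono_ae (h.mono fun ω hω => hω.trans)

theorem hasStableLaw_iff {X : ℕ → Q.Ω → ℝ} (hX : ∀ j, Measurable (X j))
    {ν : ProbabilityMeasure ℝ} :
    Q.HasStableLaw X ν ↔ Tendsto (fun j => Q.distribution (X j) (hX j)) atTop (𝓝 ν) := by
  have hν : (⟨(ν : Measure ℝ).map id, Measure.isProbabilityMeasure_map aemeasurable_id⟩ :
      ProbabilityMeasure ℝ) = ν := Subtype.ext Measure.map_id
  refine ⟨fun h => ?_, fun h => ⟨fun j => (hX j).aemeasurable, aemeasurable_id, ?_⟩⟩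
  · exact hν ▸ h.tendsto
  · exact hν.symm ▸ h

theorem Stationary.distribution_comp_shift (hQ : Q.Stationary) {F : Path n → ℝ}
    (hF : Measurable F) :
    Q.distribution (fun ω => F (Q.path ω).shift)
      (hF.comp (Path.measurable_shift.comp Q.measurable_path)) =
      Q.distribution (fun ω => F (Q.path ω)) (hF.comp Q.measurable_path) := by
  refine Subtype.ext ?_
  calc Q.P.map (F ∘ Path.shift ∘ Q.path)
      = (Q.P.map (Path.shift ∘ Q.path)).map F :=
        (Measure.map_map hF (Path.measurable_shift.comp Q.measurable_path)).symm
    _ = (Q.P.map Q.path).map F := congrArg _ hQ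
    _ = Q.P.map (F ∘ Q.path) := Measure.map_map hF Q.measurable_path

end Distributions

section Sojourns

variable {k n : ℕ}

theorem measurable_basicSojourn (Q : Input.{u} n) (j : ℕ) : Measurable (Q.basicSojourn j) :=
  (Measurable.iSup fun i => (Path.measurable_finish j i).comp Q.measurable_path).sub
    ((Path.measurable_arrival j).comp Q.measurable_path)

theorem measurable_nonPurgingSojourn (Q : Input.{u} n) (hk : 1 ≤ k) (hkn : k ≤ n) (j : ℕ) :
    Measurable (Q.nonPurgingSojourn k j) :=
  ((measurable_orderStat hk hkn).comp (measurable_pi_lambda _ fun i =>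
    (Path.measurable_finish j i).comp Q.measurable_path)).sub
    ((Path.measurable_arrival j).comp Q.measurable_path)

theorem purgingSojourn_eq (Q : Input.{u} n) (k j : ℕ) :
    Q.purgingSojourn k j = fun ω => (Q.path ω).purgingSojourn k j :=
  rfl

theorem measurable_purgingSojourn (Q : Input.{u} n) (hk : 1 ≤ k) (hkn : k ≤ n) (j : ℕ) :
    Measurable (Q.purgingSojourn k j) := by
  rw [purgingSojourn_eq]
  exact (Path.measurable_purgingSojourn hk hkn j).comp Q.measurable_path

theorem nonPurgingSojourn_le_iff (Q : Input.{u} n) (hk : 1 ≤ k) (hkn : k ≤ n) (j : ℕ) (ω : Q.Ω)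
    (t : ℝ) :
    Q.nonPurgingSojourn k j ω ≤ t ↔
      k ≤ (Finset.univ.filter fun i => (Q.path ω).nodeSojourn j i ≤ t).card := by
  rw [nonPurgingSojourn, sub_le_iff_le_add, orderStat_le_iff hk hkn]
  simp only [Path.nodeSojourn, sub_le_iff_le_add, path]

theorem purgingSojourn_le_nonPurgingSojourn (Q : Input.{u} n) (hk : 1 ≤ k) (hkn : k ≤ n) (j : ℕ) :
    Q.purgingSojourn k j ≤ Q.nonPurgingSojourn k j :=
  fun _ => sub_le_sub_right (orderStat_mono hk hkn (purgingFinish_le_finish k _ _ j)) _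

theorem purgingSojourn_nonneg (Q : Input.{u} n) (hk : 1 ≤ k) (hkn : k ≤ n) (j : ℕ) :
    ∀ᵐ ω ∂Q.P, 0 ≤ Q.purgingSojourn k j ω := by
  filter_upwards [ae_all_iff.2 fun j => ae_all_iff.2 (Q.service_nonneg j)] with ω hω
  exact sub_nonneg.2 (le_orderStat hk hkn (arrival_le_purgingFinish k _ hω j))

theorem Stationary.stochasticallyLE_purgingSojourn_succ {Q : Input.{u} n} (hQ : Q.Stationary)
    (hk : 1 ≤ k) (hkn : k ≤ n) (j : ℕ) :
    StochasticallyLE (Q.distribution _ (Q.measurable_purgingSojourn hk hkn j))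
      (Q.distribution _ (Q.measurable_purgingSojourn hk hkn (j + 1))) := by
  have heq := hQ.distribution_comp_shift (Path.measurable_purgingSojourn hk hkn j)
  simp only [purgingSojourn_eq, ← heq]
  exact stochasticallyLE_distribution _ _
    (.of_forall fun ω => Path.purgingSojourn_shift_le hk hkn j (Q.path ω))

theorem Homogeneous.measureReal_nonPurgingSojourn_le {Q : Input.{u} n} (hQ : Q.Homogeneous)
    (hk : 1 ≤ k) (hkn : k ≤ n) {B : (i : ℕ) → Input.{v} i}
    (hB : ∀ i ∈ Finset.Icc k n, (B i).Equivalent Q) (j : ℕ) (t : ℝ) :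
    Q.P.real {ω | Q.nonPurgingSojourn k j ω ≤ t} =
      ∑ i ∈ Finset.Icc k n, (coeffW n k i : ℝ) * (B i).P.real {ω | (B i).basicSojourn j ω ≤ t} := by
  have hnode : ∀ i, MeasurableSet {ω | (Q.path ω).nodeSojourn j i ≤ t} := fun i =>
    measurableSet_le ((Path.measurable_nodeSojourn j i).comp Q.measurable_path) measurable_const
  have h := measureReal_le_card_filter_of_card (μ := Q.P) hnode k
    (q := fun i => (B i).P.real {ω | (B i).basicSojourn j ω ≤ t}) fun I hI =>
      (hQ.measureReal_basicSojourn_le (Finset.card_pos.1 (hk.trans hI))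
        (hB _ (Finset.mem_Icc.2 ⟨hI, card_finset_fin_le I⟩)) j t).symm
  simpa only [Q.nonPurgingSojourn_le_iff hk hkn, Fintype.card_fin] using h

end Sojourns

section StableLaws

variable {k n : ℕ} {Q : Input.{u} n} {ν : ProbabilityMeasure ℝ}

theorem Homogeneous.exists_hasStableLaw_nonPurgingSojourn (hQ : Q.Homogeneous) (hk : 1 ≤ k)
    (hkn : k ≤ n) {B : (i : ℕ) → Input.{v} i} (hB : ∀ i ∈ Finset.Icc k n, (B i).Equivalent Q)
    {β : ℕ → ProbabilityMeasure ℝ}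
    (hβ : ∀ i ∈ Finset.Icc k n, (B i).HasStableLaw (B i).basicSojourn (β i)) :
    ∃ ν : ProbabilityMeasure ℝ, Q.HasStableLaw (Q.nonPurgingSojourn k) ν ∧
      IsLinearCombination (Finset.Icc k n) (fun i => (coeffW n k i : ℝ))
        (fun i => (β i).toFiniteMeasure) ν.toFiniteMeasure := by
  have hcomb : ∀ j, IsLinearCombination (Finset.Icc k n) (fun i => (coeffW n k i : ℝ))
      (fun i => ((B i).distribution _ ((B i).measurable_basicSojourn j)).toFiniteMeasure)
      (Q.distribution _ (Q.measurable_nonPurgingSojourn hk hkn j)).toFiniteMeasure := fun j =>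
    isLinearCombination_of_measureReal_Iic fun t => by
      simpa only [ProbabilityMeasure.toMeasure_comp_toFiniteMeasure_eq_toMeasure,
        distribution_real_Iic] using hQ.measureReal_nonPurgingSojourn_le hk hkn hB j t
  obtain ⟨μ₀, hμ₀, htendsto⟩ := exists_isLinearCombination_and_tendsto hcomb fun i hi =>
    (ProbabilityMeasure.tendsto_nhds_iff_toFiniteMeasure_tendsto_nhds atTop).1
      ((hasStableLaw_iff (B i).measurable_basicSojourn).1 (hβ i hi))
  obtain ⟨ν, rfl, hν⟩ := exists_toFiniteMeasure_eq_and_tendsto htendsto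
  exact ⟨ν, (hasStableLaw_iff (Q.measurable_nonPurgingSojourn hk hkn)).2 hν, hμ₀⟩

theorem HasStableLaw.ae_nonneg_of_purgingSojourn {π : ProbabilityMeasure ℝ} (hk : 1 ≤ k)
    (hkn : k ≤ n) (hπ : Q.HasStableLaw (Q.purgingSojourn k) π) :
    ∀ᵐ x ∂(π : Measure ℝ), 0 ≤ x :=
  ae_mem_of_tendsto ((hasStableLaw_iff (Q.measurable_purgingSojourn hk hkn)).1 hπ) isClosed_Ici
    fun j => distribution_ae_nonneg _ (Q.purgingSojourn_nonneg hk hkn j)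

theorem HasStableLaw.stochasticallyLE_of_purgingSojourn {π : ProbabilityMeasure ℝ} (hk : 1 ≤ k)
    (hkn : k ≤ n) (hπ : Q.HasStableLaw (Q.purgingSojourn k) π)
    (hν : Q.HasStableLaw (Q.nonPurgingSojourn k) ν) : StochasticallyLE π ν :=
  .of_tendsto ((hasStableLaw_iff (Q.measurable_purgingSojourn hk hkn)).1 hπ)
    ((hasStableLaw_iff (Q.measurable_nonPurgingSojourn hk hkn)).1 hν)
    (.of_forall fun j => stochasticallyLE_distribution _ _
      (.of_forall (Q.purgingSojourn_le_nonPurgingSojourn hk hkn j)))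

theorem Stationary.exists_hasStableLaw_purgingSojourn (hQ : Q.Stationary) (hk : 1 ≤ k)
    (hkn : k ≤ n) (hν : Q.HasStableLaw (Q.nonPurgingSojourn k) ν) :
    ∃ π : ProbabilityMeasure ℝ, Q.HasStableLaw (Q.purgingSojourn k) π := by
  let πs : ℕ → ProbabilityMeasure ℝ := fun j =>
    Q.distribution _ (Q.measurable_purgingSojourn hk hkn j)
  have hmono : ∀ i j, i ≤ j → StochasticallyLE (πs i) (πs j) := fun i j hij =>
    Nat.le_induction (fun _ => le_rfl)
      (fun j _ ih => ih.trans (hQ.stochasticallyLE_purgingSojourn_succ hk hkn j)) j hij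
  have hub : ∀ j, StochasticallyLE (πs j) ν := fun j =>
    .of_tendsto tendsto_const_nhds
      ((hasStableLaw_iff (Q.measurable_nonPurgingSojourn hk hkn)).1 hν)
      ((eventually_ge_atTop j).mono fun i hji => (hmono j i hji).trans
        (stochasticallyLE_distribution _ _
          (.of_forall (Q.purgingSojourn_le_nonPurgingSojourn hk hkn i))))
  exact (StochasticallyLE.exists_tendsto_of_monotone hmono hub).imp fun π hπ =>
    (hasStableLaw_iff (Q.measurable_purgingSojourn hk hkn)).2 hπ

end StableLaws

end Input

end ForkJoin

theorem theorem7 (n k : ℕ) (hk : 1 ≤ k) (hkn : k ≤ n)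
    -- the common input of the purging and the non-purging `(n,k)` queue
    (Q : ForkJoin.Input n) (hQ : Q.Homogeneous)
    -- the equivalent basic `(i,i)` queues, with stable sojourn times of finite expectation
    (B : (i : ℕ) → ForkJoin.Input i)
    (hB : ∀ i ∈ Finset.Icc k n, (B i).Equivalent Q)
    (β : ℕ → ProbabilityMeasure ℝ)
    (hβ : ∀ i ∈ Finset.Icc k n, (B i).HasStableLaw (B i).basicSojourn (β i))
    (hβ_int : ∀ i ∈ Finset.Icc k n, Integrable (fun x : ℝ => x) (β i : Measure ℝ)) :
    -- the sum is the expected sojourn time of the non-purging queue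
    (∃ ν : ProbabilityMeasure ℝ, Q.HasStableLaw (Q.nonPurgingSojourn k) ν ∧
      Integrable (fun x : ℝ => x) (ν : Measure ℝ) ∧
      ∫ x, x ∂(ν : Measure ℝ) =
        ∑ i ∈ Finset.Icc k n, (ForkJoin.coeffW n k i : ℝ) * ∫ x, x ∂(β i : Measure ℝ)) ∧
    -- and it bounds the expected sojourn time of the purging queue
    (∀ π : ProbabilityMeasure ℝ, Q.HasStableLaw (Q.purgingSojourn k) π →
      Integrable (fun x : ℝ => x) (π : Measure ℝ) ∧
      ∫ x, x ∂(π : Measure ℝ) ≤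
        ∑ i ∈ Finset.Icc k n, (ForkJoin.coeffW n k i : ℝ) * ∫ x, x ∂(β i : Measure ℝ)) ∧
    -- the purging queue has a stable sojourn time whenever the input is stationary
    (Q.Stationary → ∃ π : ProbabilityMeasure ℝ, Q.HasStableLaw (Q.purgingSojourn k) π) := by
  obtain ⟨ν, hν, hcomb⟩ := hQ.exists_hasStableLaw_nonPurgingSojourn hk hkn hB hβ
  have hint : Integrable (fun x : ℝ => x) (ν : Measure ℝ) := hcomb.integrable hβ_int
  have hmean : ∫ x, x ∂(ν : Measure ℝ) =
      ∑ i ∈ Finset.Icc k n, (ForkJoin.coeffW n k i : ℝ) * ∫ x, x ∂(β i : Measure ℝ) :=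
    hcomb.integral_eq hβ_int
  refine ⟨⟨ν, hν, hint, hmean⟩, fun π hπ => ?_, fun hS =>
    hS.exists_hasStableLaw_purgingSojourn hk hkn hν⟩
  have hπ_nonneg := hπ.ae_nonneg_of_purgingSojourn hk hkn
  have hπν := hπ.stochasticallyLE_of_purgingSojourn hk hkn hν
  exact ⟨hπν.integrable hπ_nonneg hint, hmean ▸ hπν.integral_le hπ_nonneg hint⟩
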